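/- All graphs are finite, simple and non-empty. A clique $K\subseteq V(G)$ (possibly empty) is a clique cut-set of a graph $G$ if $G\setminus K$ is disconnected, and an atom is a graph with no clique cut-set. A graph is $(H_1,H_2)$-free if it has no induced subgraph isomorphic to $H_1$ or $H_2$. The clique-width $\mathrm{cw}(G)$ is the minimum number of labels needed to construct $G$ using the operations: create a single vertex with label $i$; take the disjoint union of two labelled graphs; add all edges between vertices with label $i$ and vertices with label $j$ ($i\neq j$); relabel every vertex with label $i$ to have label $j$. A class of graphs has bounded clique-width if there is a constant $c$ with $\mathrm{cw}(G)\le c$ for all its members $G$, and unbounded clique-width otherwise. Let $P_t$ be the path on $t$ vertices, $+$ the disjoint union, $2P_2=P_2+P_2$, and $\overline{H}$ the complement of $H$. For $n\ge 2$ let $G_n$ be the following graph. Start with the vertex set $A\cup B\cup C$, where $A=\{v_{i,0} : 1\le i\le n\}$, $B=\{v_{0,j} : 1\le j\le n+1\}$ and $C=\{v_{i,j} : 1\le i,j\le n\}$, and, for all $i,j,k\in\{1,\dots,n\}$, make $v_{i,j}$ adjacent to $v_{k,0}$ if $k\ge i$, to $v_{0,k}$ if $k\ge j$, and to $v_{0,n+1}$,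 with no other edges. Then apply a bipartite complementation between $A$ and $B$ (exchange edges and non-edges between $A$ and $B$) and a complementation to $A$ (exchange edges and non-edges between distinct vertices of $A$). Then the class of $(2P_2,\overline{P_2+P_4})$-free atoms has unbounded clique-width. More precisely, for every $n\ge 2$ the graph $G_n$ is a $(2P_2,\overline{P_2+P_4})$-free atom, and the family $(G_n)_{n\ge 2}$ has unbounded clique-width. -/

import Mathlib

namespace AtomCW

/-! ### Clique-width -/

/-- Expressions over the four clique-width operations, using labels from `Fin k`. -/
inductive CWExpr (k : ℕ) : Type
  /-- a single vertex with label `i` -/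
  | vertex (i : Fin k) : CWExpr k
  /-- disjoint union of two labelled graphs -/
  | union (s t : CWExpr k) : CWExpr k
  /-- add all edges between label `i` and label `j`, where `i ≠ j` -/
  | join (i j : Fin k) (h : i ≠ j) (t : CWExpr k) : CWExpr k
  /-- relabel every vertex with label `i` to have label `j` -/
  | relabel (i j : Fin k) (t : CWExpr k) : CWExpr k

namespace CWExpr

/-- The vertex set of the labelled graph constructed by an expression. -/
def Verts {k : ℕ} : CWExpr k → Type
  | vertex _ => Unit
  | union s t => s.Verts ⊕ t.Verts
  | join _ _ _ t => t.Verts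
  | relabel _ _ t => t.Verts

/-- The labels of the vertices of the labelled graph constructed by an expression. -/
def label {k : ℕ} : (t : CWExpr k) → t.Verts → Fin k
  | vertex i => fun _ => i
  | union s t => Sum.elim s.label t.label
  | join _ _ _ t => t.label
  | relabel i j t => fun v => if t.label v = i then j else t.label v

/-- The edges of the labelled graph constructed by an expression. -/
def graph {k : ℕ} : (t : CWExpr k) → SimpleGraph t.Verts
  | vertex _ => (⊥ : SimpleGraph Unit)
  | union s t => s.graph ⊕g t.graph
  | join i j h t =>
    { Adj := fun u v => t.graph.Adj u v ∨ (t.label u = i ∧ t.label v = j) ∨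
        (t.label u = j ∧ t.label v = i)
      symm := ⟨by
        rintro u v (huv | ⟨hu, hv⟩ | ⟨hu, hv⟩)
        · exact Or.inl huv.symm
        · exact Or.inr (Or.inr ⟨hv, hu⟩)
        · exact Or.inr (Or.inl ⟨hv, hu⟩)⟩
      loopless := ⟨by
        rintro u (hu | ⟨hi, hj⟩ | ⟨hj, hi⟩)
        · exact t.graph.irrefl hu
        · exact h (hi.symm.trans hj)
        · exact h (hi.symm.trans hj)⟩ }
  | relabel _ _ t => t.graph

end CWExpr

/-- `G` can be constructed by the four operations using at most `k` labels. -/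
def ConstructibleWith {V : Type*} (G : SimpleGraph V) (k : ℕ) : Prop :=
  ∃ t : CWExpr k, Nonempty (t.graph ≃g G)

/-- The clique-width of `G`: the minimum number of labels needed to construct `G`.
The set is non-empty for every non-empty finite graph, by `exists_constructibleWith` below. -/
noncomputable def cliqueWidth {V : Type*} (G : SimpleGraph V) : ℕ :=
  sInf {k : ℕ | ConstructibleWith G k}

theorem exists_expr_bot (k : ℕ) (V : Type) [Finite V] :
    Nonempty V → ∀ lab : V → Fin k, ∃ (t : CWExpr k) (e : V ≃ t.Verts),
      (∀ u v, ¬ t.graph.Adj u v) ∧ ∀ v, t.label (e v) = lab v := by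
  induction V using Finite.induction_empty_option with
  | of_equiv f ih =>
    intro hne lab
    obtain ⟨t, e, h1, h2⟩ := ih (hne.map f.symm) (lab ∘ f)
    exact ⟨t, f.symm.trans e, h1, fun v => by simp [h2]⟩
  | h_empty => intro hne; exact hne.elim (fun x => x.elim)
  | @h_option α _ ih =>
    intro _ lab
    rcases isEmpty_or_nonempty α with hα | hα
    · refine ⟨.vertex (lab none),
        ⟨fun _ => (), fun _ => none, ?_, fun _ => rfl⟩, fun _ _ h => h, ?_⟩
      · rintro (_ | a)
        · rfl
        · exact hα.elim a
      · rintro (_ | a)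
        · rfl
        · exact hα.elim a
    · obtain ⟨t, e, h1, h2⟩ := ih hα (lab ∘ some)
      refine ⟨.union t (.vertex (lab none)),
        (Equiv.optionEquivSumPUnit α).trans (Equiv.sumCongr e (Equiv.refl _)), ?_, ?_⟩
      · rintro (u | u) (v | v) h
        · exact h1 u v h
        · cases h
        · cases h
        · exact h
      · rintro (_ | a)
        · rfl
        · exact h2 a

theorem exists_constructibleWith {V : Type} [Finite V] [Nonempty V] (G : SimpleGraph V) :
    ∃ k, ConstructibleWith G k := by
  obtain ⟨k, ⟨f⟩⟩ := Finite.exists_equiv_fin V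
  refine ⟨k, ?_⟩
  have key : ∀ s : Set (V × V), s.Finite → (∀ p ∈ s, p.1 ≠ p.2) →
      ∃ (t : CWExpr k) (e : V ≃ t.Verts),
        (∀ u v, t.graph.Adj (e u) (e v) ↔ (u, v) ∈ s ∨ (v, u) ∈ s) ∧
        ∀ v, t.label (e v) = f v := by
    intro s hs
    induction s, hs using Set.Finite.induction_on with
    | empty =>
      intro _
      obtain ⟨t, e, h1, h2⟩ := exists_expr_bot k V inferInstance f
      exact ⟨t, e, fun u v => by simp [h1], h2⟩
    | @insert p s _ _ ih =>
      intro hp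
      obtain ⟨t, e, h1, h2⟩ := ih (fun q hq => hp q (Set.mem_insert_of_mem _ hq))
      have hne : f p.1 ≠ f p.2 := fun h => hp p (Set.mem_insert _ _) (f.injective h)
      refine ⟨.join (f p.1) (f p.2) hne t, e, fun u v => ?_, h2⟩
      change (t.graph.Adj (e u) (e v) ∨ (t.label (e u) = f p.1 ∧ t.label (e v) = f p.2) ∨
        (t.label (e u) = f p.2 ∧ t.label (e v) = f p.1)) ↔ _
      simp only [h1, h2, f.injective.eq_iff, Set.mem_insert_iff, Prod.ext_iff]
      tauto
  obtain ⟨t, e, h1, _⟩ := key {p | G.Adj p.1 p.2} (Set.toFinite _) (fun p hp => G.ne_of_adj hp)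
  refine ⟨t, ⟨(⟨e, fun {u v} => ?_⟩ : G ≃g t.graph).symm⟩⟩
  rw [h1]
  exact ⟨fun h => h.elim id fun h => SimpleGraph.Adj.symm h, Or.inl⟩

/-- A class of graphs; only its non-empty finite members are considered below. -/
def GraphClass : Type 1 := ∀ V : Type, SimpleGraph V → Prop

/-- A class of (finite, non-empty) graphs has bounded clique-width. -/
def BoundedCliqueWidth (𝒢 : GraphClass) : Prop :=
  ∃ c : ℕ, ∀ (V : Type) [Finite V] [Nonempty V] (G : SimpleGraph V),
    𝒢 V G → cliqueWidth G ≤ c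

/-! ### Atoms and forbidden induced subgraphs -/

/-- A clique `K` is a clique cut-set if `G ∖ K` is disconnected
(the graph without vertices does not count as disconnected; `K` may be empty). -/
def IsCliqueCutset {V : Type*} (G : SimpleGraph V) (K : Set V) : Prop :=
  G.IsClique K ∧ ¬ (G.induce Kᶜ).Preconnected

/-- An atom is a graph with no clique cut-set. -/
def IsCliqueAtom {V : Type*} (G : SimpleGraph V) : Prop :=
  ∀ K : Set V, ¬ IsCliqueCutset G K

/-- `G` is `H`-free: it has no induced subgraph isomorphic to `H`. -/
def IndFree {W V : Type*} (H : SimpleGraph W) (G : SimpleGraph V) : Prop :=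
  ¬ H.IsIndContained G

/-- The graph `2P₂`. -/
def twoP2 : SimpleGraph (Fin 2 ⊕ Fin 2) :=
  SimpleGraph.pathGraph 2 ⊕g SimpleGraph.pathGraph 2

/-- The complement of `P₂ + P₄`. -/
def coP2P4 : SimpleGraph (Fin 2 ⊕ Fin 4) :=
  (SimpleGraph.pathGraph 2 ⊕g SimpleGraph.pathGraph 4)ᶜ

/-- The class of `(2P₂, co-(P₂+P₄))`-free atoms. -/
def twoP2_coP2P4_freeAtoms : GraphClass := fun _ G =>
  IsCliqueAtom G ∧ IndFree twoP2 G ∧ IndFree coP2P4 G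

/-! ### The grid-like graphs -/

/-- Subgraph complementation with respect to the subgraph induced by `S`. -/
def subgraphComplementation {V : Type*} (G : SimpleGraph V) (S : Set V) : SimpleGraph V where
  Adj u v := u ≠ v ∧ Xor (G.Adj u v) (u ∈ S ∧ v ∈ S)
  symm := ⟨fun u v h => ⟨h.1.symm, by simpa only [G.adj_comm v u, and_comm] using h.2⟩⟩
  loopless := ⟨fun _ h => h.1 rfl⟩

/-- Bipartite complementation with respect to the (disjoint) vertex sets `S` and `T`. -/
def bipartiteComplementation {V : Type*} (G : SimpleGraph V) (S T : Set V) :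
    SimpleGraph V where
  Adj u v := u ≠ v ∧ Xor (G.Adj u v) ((u ∈ S ∧ v ∈ T) ∨ (u ∈ T ∧ v ∈ S))
  symm := ⟨fun u v h => ⟨h.1.symm, by
    simpa only [G.adj_comm v u, and_comm, or_comm] using h.2⟩⟩
  loopless := ⟨fun _ h => h.1 rfl⟩

/-- The vertices `v_{i,j}` with `i, j ∈ {0, …, n}`, `(i, j) ≠ (0, 0)`, together with
`v_{0,n+1}`.  Positive indices are shifted down by one. -/
inductive GridVertex (n : ℕ) : Type
  /-- `a i` is `v_{i+1,0}` -/
  | a (i : Fin n) : GridVertex n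
  /-- `b j` is `v_{0,j+1}` -/
  | b (j : Fin (n + 1)) : GridVertex n
  /-- `c i j` is `v_{i+1,j+1}` -/
  | c (i j : Fin n) : GridVertex n

/-- The grid-like graph before the complementations: `v_{i,j}` is adjacent to `v_{k,0}` if
`k ≥ i`, to `v_{0,k}` if `k ≥ j`, and to `v_{0,n+1}` (`1 ≤ i, j, k ≤ n`); there are no other
edges. -/
def baseGrid (n : ℕ) : SimpleGraph (GridVertex n) :=
  SimpleGraph.fromRel fun u v =>
    match u, v with
    | .c i _, .a k => i ≤ k
    | .c _ j, .b k => (j : ℕ) ≤ (k : ℕ) ∨ k = Fin.last n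
    | _, _ => False

/-- The vertex set `A = {v_{i,0} : 1 ≤ i ≤ n}`. -/
def gridA (n : ℕ) : Set (GridVertex n) := Set.range GridVertex.a

/-- The vertex set `B = {v_{0,j} : 1 ≤ j ≤ n + 1}`. -/
def gridB (n : ℕ) : Set (GridVertex n) := Set.range GridVertex.b

/-- The graph `G_n`: a bipartite complementation between `A` and `B` and a complementation
of `A`, applied to the grid-like graph. -/
def gridGraph (n : ℕ) : SimpleGraph (GridVertex n) :=
  subgraphComplementation (bipartiteComplementation (baseGrid n) (gridA n) (gridB n)) (gridA n)

end AtomCW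

namespace AtomCW

/-! ### Adjacency in `gridGraph` -/

section Adjacency

variable {n : ℕ}

/-! After the complementations `A` is a clique complete to `B`, the sets `B` and `C` are
independent, and `C` is joined to `A` by row index and to `B` by column index, in half-graph
fashion. Nested neighbourhoods exclude the two forbidden subgraphs.

For clique-width, an expression with `k` labels yields a set `S` with at most `k` neighbourhood
types towards its complement, and with neither side containing too few vertices of `C`
(`ConstructibleWith.exists_balanced_separatesTypes`). The half graphs allow at most `2k` rows and
`2k` columns of `C` to meet both sides (`SeparatesTypes.card_mixedLines_le`). Every unmixed row
crosses every unmixed column, so all of `C` except at most `4k²` crossings lies on one side, against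
the balance of `S`. -/

@[simp] theorem gridGraph_adj_a_a (i k : Fin n) :
    (gridGraph n).Adj (.a i) (.a k) ↔ i ≠ k := by
  simp [gridGraph, subgraphComplementation, bipartiteComplementation, baseGrid, gridA, gridB,
    Xor]

@[simp] theorem gridGraph_adj_a_b (i : Fin n) (k : Fin (n + 1)) :
    (gridGraph n).Adj (.a i) (.b k) := by
  simp [gridGraph, subgraphComplementation, bipartiteComplementation, baseGrid, gridA, gridB,
    Xor]

@[simp] theorem gridGraph_adj_b_a (i : Fin n) (k : Fin (n + 1)) :
    (gridGraph n).Adj (.b k) (.a i) :=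
  (gridGraph_adj_a_b i k).symm

@[simp] theorem gridGraph_adj_b_b (j k : Fin (n + 1)) :
    ¬ (gridGraph n).Adj (.b j) (.b k) := by
  simp [gridGraph, subgraphComplementation, bipartiteComplementation, baseGrid, gridA, gridB,
    Xor]

@[simp] theorem gridGraph_adj_c_c (i j i' j' : Fin n) :
    ¬ (gridGraph n).Adj (.c i j) (.c i' j') := by
  simp [gridGraph, subgraphComplementation, bipartiteComplementation, baseGrid, gridA, gridB,
    Xor]

@[simp] theorem gridGraph_adj_c_a (i j k : Fin n) :
    (gridGraph n).Adj (.c i j) (.a k) ↔ (i : ℕ) ≤ k := by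
  simp [gridGraph, subgraphComplementation, bipartiteComplementation, baseGrid, gridA, gridB,
    Xor]

@[simp] theorem gridGraph_adj_a_c (i j k : Fin n) :
    (gridGraph n).Adj (.a k) (.c i j) ↔ (i : ℕ) ≤ k := by
  rw [SimpleGraph.adj_comm, gridGraph_adj_c_a]

@[simp] theorem gridGraph_adj_c_b (i j : Fin n) (k : Fin (n + 1)) :
    (gridGraph n).Adj (.c i j) (.b k) ↔ (j : ℕ) ≤ k := by
  -- With indices from 0, `Fin.last n` exceeds every column index, so the special clause for it is
  -- absorbed by the inequality.
  have hlast : k = Fin.last n → (j : ℕ) ≤ k := by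
    rintro rfl
    simp
  simpa [gridGraph, subgraphComplementation, bipartiteComplementation, baseGrid, gridA, gridB,
    Xor] using hlast

@[simp] theorem gridGraph_adj_b_c (i j : Fin n) (k : Fin (n + 1)) :
    (gridGraph n).Adj (.b k) (.c i j) ↔ (j : ℕ) ≤ k := by
  rw [SimpleGraph.adj_comm, gridGraph_adj_c_b]

end Adjacency

/-! ### Forbidden induced subgraphs -/

/-- A vertex of `A` in one edge forces the other edge into the independent set `C`. Hence both edges
run between `B` and `C`, where neighbourhoods are nested. -/
theorem indFree_twoP2_gridGraph (n : ℕ) : IndFree twoP2 (gridGraph n) := by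
  rintro ⟨φ⟩
  have h (u v) : (gridGraph n).Adj (φ u) (φ v) ↔ twoP2.Adj u v := φ.map_adj_iff
  have h1 := h (.inl 0) (.inl 1)
  have h2 := h (.inr 0) (.inr 1)
  have h3 := h (.inl 0) (.inr 0)
  have h4 := h (.inl 0) (.inr 1)
  have h5 := h (.inl 1) (.inr 0)
  have h6 := h (.inl 1) (.inr 1)
  have n3 := φ.injective.ne (a₁ := .inl 0) (a₂ := .inr 0) (by simp)
  have n4 := φ.injective.ne (a₁ := .inl 0) (a₂ := .inr 1) (by simp)
  have n5 := φ.injective.ne (a₁ := .inl 1) (a₂ := .inr 0) (by simp)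
  have n6 := φ.injective.ne (a₁ := .inl 1) (a₂ := .inr 1) (by simp)
  simp only [twoP2, SimpleGraph.sum_adj, SimpleGraph.pathGraph_adj] at h1 h2 h3 h4 h5 h6
  generalize φ (.inl 0) = x at *
  generalize φ (.inl 1) = y at *
  generalize φ (.inr 0) = z at *
  generalize φ (.inr 1) = w at *
  cases x <;> cases y <;> simp at h1 <;> cases z <;> simp at h3 h5 n3 n5 <;>
    cases w <;> simp at h2 h4 h6 n4 n6 <;> omega

/-- The non-adjacent pair `p`, `q` is complete to an induced `P₄`. If both lie in `B`, the path lies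
in `A ∪ C`; otherwise one lies in `C` and the path lies in `A ∪ B`. Both sets induce threshold
graphs, which contain no `P₄`. -/
theorem indFree_coP2P4_gridGraph (n : ℕ) : IndFree coP2P4 (gridGraph n) := by
  rintro ⟨φ⟩
  have h (u v) : (gridGraph n).Adj (φ u) (φ v) ↔ coP2P4.Adj u v := φ.map_adj_iff
  have hpq := h (.inl 0) (.inl 1)
  have npq := φ.injective.ne (a₁ := .inl 0) (a₂ := .inl 1) (by simp)
  have p0 := h (.inl 0) (.inr 0)
  have p1 := h (.inl 0) (.inr 1)
  have p2 := h (.inl 0) (.inr 2)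
  have p3 := h (.inl 0) (.inr 3)
  have q0 := h (.inl 1) (.inr 0)
  have q1 := h (.inl 1) (.inr 1)
  have q2 := h (.inl 1) (.inr 2)
  have q3 := h (.inl 1) (.inr 3)
  have h01 := h (.inr 0) (.inr 1)
  have h12 := h (.inr 1) (.inr 2)
  have h23 := h (.inr 2) (.inr 3)
  have h02 := h (.inr 0) (.inr 2)
  have h13 := h (.inr 1) (.inr 3)
  have h03 := h (.inr 0) (.inr 3)
  have n01 := φ.injective.ne (a₁ := .inr 0) (a₂ := .inr 1) (by simp)
  have n12 := φ.injective.ne (a₁ := .inr 1) (a₂ := .inr 2) (by simp)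
  have n23 := φ.injective.ne (a₁ := .inr 2) (a₂ := .inr 3) (by simp)
  clear h
  simp [coP2P4, SimpleGraph.compl_adj, SimpleGraph.sum_adj, SimpleGraph.pathGraph_adj] at *
  generalize φ (.inl 0) = p at *
  generalize φ (.inl 1) = q at *
  generalize φ (.inr 0) = x at *
  generalize φ (.inr 1) = y at *
  generalize φ (.inr 2) = z at *
  generalize φ (.inr 3) = w at *
  cases p <;> cases q <;> simp at hpq npq <;> try contradiction
  all_goals
    cases x <;> simp at p0 q0 <;> cases y <;> simp at p1 q1 h01 n01 <;>
    cases z <;> simp at p2 q2 h02 h12 n12 <;>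
    cases w <;> simp at p3 q3 h03 h13 h23 n23 <;> omega

/-! ### Clique cut-sets -/

theorem isCliqueAtom_gridGraph {n : ℕ} (hn : 2 ≤ n) : IsCliqueAtom (gridGraph n) := by
  rintro K ⟨hK, hcon⟩
  apply hcon
  -- The last two vertices of `B` are complete to `A ∪ C` and not adjacent to each other, so a
  -- clique misses one of them.
  have hub : ∃ k : Fin (n + 1), n - 1 ≤ (k : ℕ) ∧ GridVertex.b k ∉ K := by
    by_contra! h
    have h1 := h (Fin.last n) (by simp)
    have h2 := h ⟨n - 1, by omega⟩ le_rfl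
    exact gridGraph_adj_b_b _ _ (hK h1 h2 (by simp [Fin.ext_iff]; omega))
  -- A vertex of the first column is complete to `B`; it links the rest of `B` to the hub.
  have free : ∃ i : Fin n, GridVertex.c i ⟨0, by omega⟩ ∉ K := by
    by_contra! h
    exact gridGraph_adj_c_c _ _ _ _
      (hK (h ⟨0, by omega⟩) (h ⟨1, by omega⟩) (by simp))
  obtain ⟨k, hk, hkK⟩ := hub
  obtain ⟨i, hi⟩ := free
  have toHub (v : (Kᶜ : Set (GridVertex n))) :
      ((gridGraph n).induce Kᶜ).Reachable v ⟨.b k, hkK⟩ := by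
    have hc (i j : Fin n) (h : GridVertex.c i j ∉ K) :
        ((gridGraph n).induce Kᶜ).Reachable ⟨.c i j, h⟩ ⟨.b k, hkK⟩ := by
      apply SimpleGraph.Adj.reachable
      simp
      omega
    obtain ⟨v | v | ⟨i', j'⟩, hv⟩ := v
    · apply SimpleGraph.Adj.reachable
      simp
    · refine (SimpleGraph.Adj.reachable ?_).trans (hc i ⟨0, by omega⟩ hi)
      simp
    · exact hc i' j' hv
  exact fun u v => (toHub u).trans (toHub v).symm

theorem gridGraph_mem_freeAtoms {n : ℕ} (hn : 2 ≤ n) :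
    twoP2_coP2P4_freeAtoms (GridVertex n) (gridGraph n) :=
  ⟨isCliqueAtom_gridGraph hn, indFree_twoP2_gridGraph n, indFree_coP2P4_gridGraph n⟩

/-! ### Balanced cuts with few neighbourhood types -/

instance CWExpr.finite_verts {k : ℕ} : (t : CWExpr k) → Finite t.Verts
  | .vertex _ => inferInstanceAs (Finite Unit)
  | .union s t =>
    have := s.finite_verts
    have := t.finite_verts
    inferInstanceAs (Finite (s.Verts ⊕ t.Verts))
  | .join _ _ _ t => t.finite_verts
  | .relabel _ _ t => t.finite_verts

/-- `f` colours the vertices so that equally coloured vertices of `S` have the same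
neighbours outside `S`. -/
def SeparatesTypes {V α : Type*} (G : SimpleGraph V) (S : Set V) (f : V → α) : Prop :=
  ∀ u ∈ S, ∀ v ∈ S, f u = f v → ∀ w ∉ S, G.Adj u w ↔ G.Adj v w

/-- A cut of an induced subgraph that is a union of components is a cut of the whole graph. -/
theorem exists_separatesTypes_image {V V' L α : Type*} {G : SimpleGraph V} {G' : SimpleGraph V'}
    {l : V → L} {l' : V' → L} (φ : G ↪g G') (hl : ∀ v, l' (φ v) = l v)
    (hout : ∀ v, ∀ w ∉ Set.range φ, ¬ G'.Adj (φ v) w) (W : Set V') {S : Set V} {f : V → α}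
    (g : V' → α) (hf : ∀ u ∈ S, ∀ v ∈ S, f u = f v → l u = l v) (hS : SeparatesTypes G S f) :
    ∃ (S' : Set V') (f' : V' → α), (W ∩ S').ncard = (φ ⁻¹' W ∩ S).ncard ∧
      (∀ u ∈ S', ∀ v ∈ S', f' u = f' v → l' u = l' v) ∧ SeparatesTypes G' S' f' := by
  refine ⟨φ '' S, Function.extend φ f g, ?_, ?_, ?_⟩
  · rw [Set.inter_comm, ← Set.image_inter_preimage, Set.ncard_image_of_injective _ φ.injective,
      Set.inter_comm]
  · rintro _ ⟨u, hu, rfl⟩ _ ⟨v, hv, rfl⟩ huv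
    rw [φ.injective.extend_apply, φ.injective.extend_apply] at huv
    rw [hl, hl, hf u hu v hv huv]
  · rintro _ ⟨u, hu, rfl⟩ _ ⟨v, hv, rfl⟩ huv w hw
    rw [φ.injective.extend_apply, φ.injective.extend_apply] at huv
    by_cases hr : w ∈ Set.range φ
    · obtain ⟨w, rfl⟩ := hr
      rw [φ.map_adj_iff, φ.map_adj_iff]
      exact hS u hu v hv huv w fun h => hw ⟨w, h, rfl⟩
    · exact iff_of_false (hout u w hr) (hout v w hr)

/-- Descend to a side of each union holding more than `q` vertices of `W`, until at most `2q`
remain; the labels there are the colours. Later operations treat equally labelled vertices alike, so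
the induction also carries that colours refine labels. -/
theorem CWExpr.exists_balanced_refining_label {k q : ℕ} (hq : 1 ≤ q) (t : CWExpr k)
    (W : Set t.Verts) (hW : q < W.ncard) :
    ∃ (S : Set t.Verts) (f : t.Verts → Fin k), q < (W ∩ S).ncard ∧ (W ∩ S).ncard ≤ 2 * q ∧
      (∀ u ∈ S, ∀ v ∈ S, f u = f v → t.label u = t.label v) ∧ SeparatesTypes t.graph S f := by
  induction t with
  | vertex i =>
    have : W.ncard ≤ 1 := (Set.ncard_le_one (hs := Set.toFinite W)).2 fun _ _ _ _ => rfl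
    omega
  | union s t ihs iht =>
    by_cases hW2 : W.ncard ≤ 2 * q
    · exact ⟨Set.univ, (union s t).label, by simpa using hW, by simpa using hW2,
        fun _ _ _ _ h => h, fun _ _ _ _ _ w hw => (hw trivial).elim⟩
    let φ : s.graph ↪g (union s t).graph := SimpleGraph.Embedding.sumInl
    let ψ : t.graph ↪g (union s t).graph := SimpleGraph.Embedding.sumInr
    have hcard : W.ncard ≤ (φ ⁻¹' W).ncard + (ψ ⁻¹' W).ncard := by
      rw [← Set.ncard_image_of_injective _ φ.injective,
        ← Set.ncard_image_of_injective _ ψ.injective]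
      refine (Set.ncard_le_ncard ?_ (Set.toFinite _)).trans (Set.ncard_union_le _ _)
      rintro (v | v) hv
      · exact Or.inl ⟨v, hv, rfl⟩
      · exact Or.inr ⟨v, hv, rfl⟩
    rcases (by omega : q < (φ ⁻¹' W).ncard ∨ q < (ψ ⁻¹' W).ncard) with h | h
    · obtain ⟨S, f, h1, h2, h3, h4⟩ := ihs _ h
      obtain ⟨S', f', h5, h6⟩ := exists_separatesTypes_image (l' := (union s t).label) φ
        (fun _ => rfl) (by
          rintro v (w | w) hw
          · exact (hw ⟨w, rfl⟩).elim
          · exact fun h => by cases h) W (union s t).label h3 h4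
      exact ⟨S', f', h5 ▸ h1, h5 ▸ h2, h6⟩
    · obtain ⟨S, f, h1, h2, h3, h4⟩ := iht _ h
      obtain ⟨S', f', h5, h6⟩ := exists_separatesTypes_image (l' := (union s t).label) ψ
        (fun _ => rfl) (by
          rintro v (w | w) hw
          · exact fun h => by cases h
          · exact (hw ⟨w, rfl⟩).elim) W (union s t).label h3 h4
      exact ⟨S', f', h5 ▸ h1, h5 ▸ h2, h6⟩
  | join i j h t ih =>
    obtain ⟨S, f, h1, h2, h3, h4⟩ := ih W hW
    refine ⟨S, f, h1, h2, h3, fun u hu v hv huv w hw => ?_⟩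
    have hl := h3 u hu v hv huv
    have ha := h4 u hu v hv huv w hw
    change (t.graph.Adj u w ∨ (t.label u = i ∧ t.label w = j) ∨
        (t.label u = j ∧ t.label w = i)) ↔ (t.graph.Adj v w ∨ (t.label v = i ∧ t.label w = j) ∨
        (t.label v = j ∧ t.label w = i))
    rw [hl, ha]
  | relabel i j t ih =>
    obtain ⟨S, f, h1, h2, h3, h4⟩ := ih W hW
    refine ⟨S, f, h1, h2, fun u hu v hv huv => ?_, h4⟩
    simp only [label]
    rw [h3 u hu v hv huv]

/-- A graph constructible with `k` labels has a balanced cut with at most `k`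
neighbourhood types. -/
theorem ConstructibleWith.exists_balanced_separatesTypes {V : Type*} {G : SimpleGraph V}
    {k q : ℕ} (hG : ConstructibleWith G k) (hq : 1 ≤ q) (W : Set V) (hW : q < W.ncard) :
    ∃ (S : Set V) (f : V → Fin k), q < (W ∩ S).ncard ∧ (W ∩ S).ncard ≤ 2 * q ∧
      SeparatesTypes G S f := by
  obtain ⟨t, ⟨e⟩⟩ := hG
  have hcard (T : Set V) : (e ⁻¹' T).ncard = T.ncard :=
    Set.ncard_preimage_of_injective_subset_range e.injective
      fun x _ => e.surjective x
  obtain ⟨S, f, h1, h2, -, h4⟩ :=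
    t.exists_balanced_refining_label hq (e ⁻¹' W) (by rwa [hcard])
  have hS : e ⁻¹' W ∩ S = e ⁻¹' (W ∩ e.symm ⁻¹' S) := by
    ext x
    simp
  rw [hS, hcard] at h1 h2
  refine ⟨e.symm ⁻¹' S, f ∘ e.symm, h1, h2, fun u hu v hv huv w hw => ?_⟩
  rw [← e.symm.map_adj_iff, ← e.symm.map_adj_iff (v := v)]
  exact h4 _ hu _ hv huv _ hw

theorem SeparatesTypes.card_le {V ι : Type*} [LinearOrder ι] {k : ℕ} {G : SimpleGraph V}
    {S : Set V} {f : V → Fin k} (hf : SeparatesTypes G S f) (I : Finset ι) (p : ι → V)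
    (hp : ∀ i ∈ I, p i ∈ S)
    (hsep : ∀ i ∈ I, ∀ j ∈ I, i < j → ∃ w ∉ S, ¬ (G.Adj (p i) w ↔ G.Adj (p j) w)) :
    I.card ≤ k := by
  have hinj : Set.InjOn (f ∘ p) I := by
    intro i hi j hj hij
    by_contra hne
    rcases lt_or_gt_of_ne hne with hlt | hlt
    · obtain ⟨w, hw, h⟩ := hsep i hi j hj hlt
      exact h (hf _ (hp i hi) _ (hp j hj) hij w hw)
    · obtain ⟨w, hw, h⟩ := hsep j hj i hi hlt
      exact h (hf _ (hp j hj) _ (hp i hi) hij.symm w hw)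
  simpa using Finset.card_le_card_of_injOn (f ∘ p) (fun _ _ => Finset.mem_univ _) hinj

open Classical in
/-- The lines `i` of the array `g` that meet both `S` and its complement. -/
noncomputable def mixedLines {V ι κ : Type*} [Fintype ι] (g : ι → κ → V) (S : Set V) :
    Finset ι :=
  {i | (∃ j, g i j ∈ S) ∧ ∃ j, g i j ∉ S}

theorem mem_of_notMem_mixedLines {V ι κ : Type*} [Fintype ι] {g : ι → κ → V} {S : Set V}
    {i : ι} (hi : i ∉ mixedLines g S) {j : κ} (hj : g i j ∈ S) (j' : κ) : g i j' ∈ S := by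
  by_contra h
  exact hi (by simpa [mixedLines] using ⟨⟨j, hj⟩, j', h⟩)

/-- Few lines of an array are mixed if the lines are told apart by a half graph. -/
theorem SeparatesTypes.card_mixedLines_le {V ι κ : Type*} [Fintype ι] [LinearOrder ι] {k : ℕ}
    {G : SimpleGraph V} {S : Set V} {f : V → Fin k} (hf : SeparatesTypes G S f)
    (g : ι → κ → V) (h : ι → V) (hadj : ∀ i j l, G.Adj (g i j) (h l) ↔ i ≤ l) :
    (mixedLines g S).card ≤ 2 * k := by
  classical
  rw [← Finset.card_filter_add_card_filter_not (s := mixedLines g S) (fun i => h i ∈ S), two_mul]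
  have hmixed : ∀ i ∈ mixedLines g S, (∃ j, g i j ∈ S) ∧ ∃ j, g i j ∉ S := by
    simp [mixedLines]
  apply add_le_add
  -- Line vertices `h i` in `S`: a vertex of line `j` outside `S` sees `h j` but not `h i` when `i <
  -- j`.
  · refine hf.card_le _ h (by simp) fun i hi j hj hij => ?_
    obtain ⟨l, hl⟩ := (hmixed j (Finset.mem_filter.1 hj).1).2
    refine ⟨g j l, hl, ?_⟩
    simp [G.adj_comm _ (g j l), hadj, hij]
  -- Line vertices `h i` outside `S`: each separates a representative in `S` of line `i` from those
  -- of later lines. The value on unmixed lines is a dummy.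
  · have hin : ∀ i, ∃ v, i ∈ mixedLines g S → v ∈ S ∧ ∀ l, G.Adj v (h l) ↔ i ≤ l := by
      intro i
      by_cases hi : i ∈ mixedLines g S
      · obtain ⟨j, hj⟩ := (hmixed i hi).1
        exact ⟨g i j, fun _ => ⟨hj, hadj i j⟩⟩
      · exact ⟨h i, fun h => (hi h).elim⟩
    choose p hp using hin
    refine hf.card_le _ p (fun i hi => (hp i (Finset.mem_filter.1 hi).1).1)
      fun i hi j hj hij => ⟨h i, (Finset.mem_filter.1 hi).2, ?_⟩
    simp [(hp i (Finset.mem_filter.1 hi).1).2, (hp j (Finset.mem_filter.1 hj).1).2, hij]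

/-- Apart from the crossings of mixed rows and mixed columns, a square array lies on one
side. -/
theorem subset_mixedLines_product {V ι : Type*} [Fintype ι] (g : ι → ι → V) (S : Set V)
    {r s : ι} (hr : r ∉ mixedLines g S) (hs : s ∉ mixedLines (fun j i => g i j) S)
    (hrs : g r s ∈ S) (i j : ι) (hij : g i j ∉ S) :
    i ∈ mixedLines g S ∧ j ∈ mixedLines (fun j i => g i j) S := by
  constructor <;> by_contra h
  · exact hij (mem_of_notMem_mixedLines h
      (mem_of_notMem_mixedLines (g := fun j i => g i j) hs hrs i) j)
  · exact hij (mem_of_notMem_mixedLines (g := fun j i => g i j) h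
      (mem_of_notMem_mixedLines hr hrs j) i)

theorem mixedLines_compl {V ι κ : Type*} [Fintype ι] (g : ι → κ → V) (S : Set V) :
    mixedLines g Sᶜ = mixedLines g S := by
  ext i
  simp [mixedLines, and_comm]

/-! ### Clique-width of `gridGraph` -/

/-- The vertices of `gridGraph`, as a disjoint union. -/
def gridVertexEquiv (n : ℕ) : GridVertex n ≃ Fin n ⊕ Fin (n + 1) ⊕ Fin n × Fin n where
  toFun
    | .a i => .inl i
    | .b j => .inr (.inl j)
    | .c i j => .inr (.inr (i, j))
  invFun
    | .inl i => .a i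
    | .inr (.inl j) => .b j
    | .inr (.inr (i, j)) => .c i j
  left_inv v := by cases v <;> rfl
  right_inv v := by rcases v with _ | _ | _ <;> rfl

instance (n : ℕ) : Finite (GridVertex n) := Finite.of_equiv _ (gridVertexEquiv n).symm

instance (n : ℕ) : Nonempty (GridVertex n) := ⟨.b 0⟩

theorem not_constructibleWith_gridGraph {n k : ℕ} (hn : 4 * k + 4 ≤ n) :
    ¬ ConstructibleWith (gridGraph n) k := by
  classical
  intro hG
  let c : Fin n × Fin n → GridVertex n := fun p => .c p.1 p.2
  have hc : Function.Injective c := fun p p' h => by simpa [c, Prod.ext_iff] using h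
  have hsq : (4 * k + 4) * (4 * k + 4) ≤ n * n := Nat.mul_le_mul hn hn
  have hcard (T : Set (GridVertex n)) :
      (Set.range c ∩ T).ncard = (Finset.univ.filter fun p => c p ∈ T).card := by
    rw [← Set.image_preimage_eq_range_inter, Set.ncard_image_of_injective _ hc,
      ← Set.ncard_coe_finset]
    congr 1
    ext p
    simp
  have htot : (Set.range c).ncard = n * n := by
    simpa using hcard Set.univ
  -- This `q` exceeds the `4k²` crossings, and `2q + 4k² < n²`, so neither side can hold only
  -- crossings; the `+ 1` keeps `q` positive for `k = 0`.
  obtain ⟨S, f, h1, h2, hf⟩ := hG.exists_balanced_separatesTypes (q := 4 * k * k + 1) (by omega)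
    (Set.range c) (by rw [htot]; nlinarith)
  rw [hcard] at h1 h2
  have hrow := hf.card_mixedLines_le GridVertex.c GridVertex.a fun i j l => by simp
  -- `castSucc` omits the last vertex of `B`, leaving one per column.
  have hcol := hf.card_mixedLines_le (fun j i => GridVertex.c i j)
    (fun j : Fin n => GridVertex.b j.castSucc) fun j i l => by simp
  have exists_notMem (M : Finset (Fin n)) (hM : M.card ≤ 2 * k) : ∃ i, i ∉ M := by
    by_contra! h
    have := Finset.card_le_card (show Finset.univ ⊆ M from fun i _ => h i)
    simp at this
    omega
  obtain ⟨r, hr⟩ := exists_notMem _ hrow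
  obtain ⟨s, hs⟩ := exists_notMem _ hcol
  have small (T : Set (GridVertex n)) (hT : ∀ i j : Fin n, .c i j ∈ T →
      i ∈ mixedLines GridVertex.c S ∧ j ∈ mixedLines (fun j i => GridVertex.c i j) S) :
      (Finset.univ.filter fun p => c p ∈ T).card ≤ 4 * k * k := by
    calc _ ≤ (mixedLines GridVertex.c S ×ˢ mixedLines (fun j i => GridVertex.c i j) S).card :=
          Finset.card_le_card fun p hp => Finset.mem_product.2 (hT p.1 p.2 (by simpa [c] using hp))
      _ ≤ (2 * k) * (2 * k) := by rw [Finset.card_product]; exact Nat.mul_le_mul hrow hcol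
      _ = _ := by ring
  by_cases hrs : GridVertex.c r s ∈ S
  · have h3 := small Sᶜ (subset_mixedLines_product _ S hr hs hrs)
    have h4 := Finset.card_filter_add_card_filter_not
      (s := (Finset.univ : Finset (Fin n × Fin n))) (fun p => c p ∈ S)
    simp only [Set.mem_compl_iff] at h3
    simp only [Finset.card_univ, Fintype.card_prod, Fintype.card_fin] at h4
    nlinarith
  · rw [← mixedLines_compl] at hr hs
    have h3 := small S fun i j hij => by
      simpa only [mixedLines_compl] using
        subset_mixedLines_product _ Sᶜ hr hs hrs i j (not_not.2 hij)
    omega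

theorem lt_cliqueWidth_gridGraph (k : ℕ) : k < cliqueWidth (gridGraph (4 * k + 4)) := by
  by_contra! h
  have hle : 4 * cliqueWidth (gridGraph (4 * k + 4)) + 4 ≤ 4 * k + 4 := by omega
  exact not_constructibleWith_gridGraph hle
    (Nat.sInf_mem (exists_constructibleWith (gridGraph (4 * k + 4))))

end AtomCW

/-- The class of `(2P₂, co-(P₂+P₄))`-free atoms has unbounded clique-width; moreover, all graphs
`G_n` with `n ≥ 2` belong to this class, and they already have unbounded clique-width. -/
theorem mainTheorem9 :
    ¬ AtomCW.BoundedCliqueWidth AtomCW.twoP2_coP2P4_freeAtoms ∧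
    (∀ n : ℕ, 2 ≤ n →
      AtomCW.twoP2_coP2P4_freeAtoms (AtomCW.GridVertex n) (AtomCW.gridGraph n)) ∧
    (∀ c : ℕ, ∃ n : ℕ, 2 ≤ n ∧ c < AtomCW.cliqueWidth (AtomCW.gridGraph n)) := by

  refine ⟨?_, fun n hn => AtomCW.gridGraph_mem_freeAtoms hn,
    fun c => ⟨4 * c + 4, by omega, AtomCW.lt_cliqueWidth_gridGraph c⟩⟩
  rintro ⟨c, hc⟩
  exact absurd (hc _ _ (AtomCW.gridGraph_mem_freeAtoms (by omega)))
    (AtomCW.lt_cliqueWidth_gridGraph c).not_ge
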